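/- Let $\overline W\cong S_3$ be the Weyl group of $sl(3)$, $\alpha_1,\alpha_2$ its simple roots, $\overline\Delta$ and $\overline\Delta_+=\{\alpha_1,\alpha_2,\alpha_1+\alpha_2\}$ the sets of roots and positive roots, $\rho$ the half-sum of the positive roots, $Q\subset P$ the root and weight lattices, and let $W=\overline W\ltimes t_Q\subset\widetilde W=\overline W\ltimes t_P$ be the affine and the extended affine Weyl groups, where $w\,t_\beta\,w^{-1}=t_{w(\beta)}$ for $w\in\overline W$, $\beta\in P$. Write $y\in\widetilde W$ uniquely as $y=\bar y\,t_{-\lambda}$ with $\bar y\in\overline W$, $\lambda\in P$, and put $$\iota(y)=3\lambda+\bar y^{-1}(\rho)-\rho\in Q .$$ Let $\widetilde{\mathcal C}$ be the dominant chamber: the set of all $y=\bar y\,t_{-\lambda}\in\widetilde W$ such that, for $i=1,2$, $y(\alpha_i)=\bar y(\alpha_i)+\langle\lambda,\alpha_i\rangle\delta$ is a positive real affine root, i.e. lies in $\overline\Delta_+\cup(\overline\Delta+\mathbb Z_{>0}\,\delta)$. Let $K_\beta$ be the Kostant partition function (the number of ways of writing $\beta$ as a sum of positive roots of $sl(3)$,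 order disregarded). For $y\in\widetilde W$ let $\mathrm{ch}(V_y)$ be the formal series $$\mathrm{ch}(V_y)=\sum_{z\in\widetilde W,\ zy^{-1}\in W}K_{\iota(y)-\iota(z)}\;z,$$ and let $$\chi_y=\sum_{w\in\overline W}\det(w)\,\mathrm{ch}(V_{yw}),$$ which is a finite sum, i.e. an element of the group ring $\mathbb Z[\widetilde W]$. The extended character ring $\widetilde{\mathcal W}$ is the subring of $\mathbb Z[\widetilde W]$ generated by $\{\chi_y: y\in\widetilde{\mathcal C}\}$. **Corollary 4.7.** The characters $\chi_y$, $y\in\widetilde{\mathcal C}$, form a $\mathbb Z$-basis of $\widetilde{\mathcal W}$, and the structure constants of $\widetilde{\mathcal W}$ with respect to this basis, i.e. the integers $N^z_{x,y}$ determined by $$\chi_x\,\chi_y=\sum_{z\in\widetilde{\mathcal C}}N^z_{x,y}\,\chi_z\qquad(x,y\in\widetilde{\mathcal C}),$$ are all nonnegative. -/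

import Mathlib

noncomputable section

namespace ExtChar

/-! ### Weights, roots and the finite Weyl group of sl(3) -/

/-- The weight lattice `P` of sl(3); the pair `(a, b)` is `a ϖ₁ + b ϖ₂` with `ϖ₁, ϖ₂` the
fundamental weights, so that `a = ⟨λ, α₁⟩` and `b = ⟨λ, α₂⟩`. -/
abbrev Weight : Type := ℤ × ℤ

/-- The simple root `α₁ = 2 ϖ₁ - ϖ₂`. -/
def root₁ : Weight := (2, -1)

/-- The simple root `α₂ = -ϖ₁ + 2 ϖ₂`. -/
def root₂ : Weight := (-1, 2)

/-- The highest root `θ = α₁ + α₂`. -/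
def rootθ : Weight := root₁ + root₂

/-- The Weyl vector `ρ = ϖ₁ + ϖ₂`. -/
def rho : Weight := (1, 1)

/-- The positive roots of sl(3). -/
def posRoots : Set Weight := {root₁, root₂, rootθ}

/-- The roots of sl(3). -/
def roots : Set Weight := {β | β ∈ posRoots ∨ -β ∈ posRoots}

/-- The root lattice `Q = ℤ α₁ ⊕ ℤ α₂`. -/
def rootLattice : AddSubgroup Weight := AddSubgroup.closure {root₁, root₂}

/-- The finite Weyl group of sl(3), the symmetric group on three letters; the simple reflections
are the transpositions of neighbours and `det` is the sign. -/
abbrev FinWeyl : Type := Equiv.Perm (Fin 3)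

/-- A weight as an integer triple (representing its class modulo `(1, 1, 1)`):
`ϖ₁ = (1, 0, 0)` and `ϖ₂ = (1, 1, 0)`. -/
def eps (l : Weight) : Fin 3 → ℤ := ![l.1 + l.2, l.2, 0]

/-- The (linear, unshifted) action of the finite Weyl group on weights: permutation of the
coordinates of the triple `eps l`. -/
def act (w : FinWeyl) (l : Weight) : Weight :=
  (eps l (w⁻¹ 0) - eps l (w⁻¹ 1), eps l (w⁻¹ 1) - eps l (w⁻¹ 2))

theorem eps_act (w : FinWeyl) (l : Weight) (i j : Fin 3) :
    eps (act w l) i - eps (act w l) j = eps l (w⁻¹ i) - eps l (w⁻¹ j) := by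
  fin_cases i <;> fin_cases j <;> simp [act, eps]

theorem act_one (l : Weight) : act 1 l = l := by
  ext <;> simp [act, eps]

theorem act_mul (v w : FinWeyl) (l : Weight) : act (v * w) l = act v (act w l) := by
  have h := eps_act w l
  ext
  · change eps l ((v * w)⁻¹ 0) - eps l ((v * w)⁻¹ 1)
      = eps (act w l) (v⁻¹ 0) - eps (act w l) (v⁻¹ 1)
    rw [h]; simp
  · change eps l ((v * w)⁻¹ 1) - eps l ((v * w)⁻¹ 2)
      = eps (act w l) (v⁻¹ 1) - eps (act w l) (v⁻¹ 2)
    rw [h]; simp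

theorem eps_add (k l : Weight) (i : Fin 3) : eps (k + l) i = eps k i + eps l i := by
  fin_cases i
  · simp [eps]; ring
  all_goals simp [eps]

theorem act_add (w : FinWeyl) (k l : Weight) : act w (k + l) = act w k + act w l := by
  ext <;> simp only [act, eps_add, Prod.fst_add, Prod.snd_add] <;> ring

theorem act_neg (w : FinWeyl) (l : Weight) : act w (-l) = -act w l := by
  have h := act_add w l (-l)
  rw [add_neg_cancel] at h
  have h0 : act w 0 = 0 := by simpa using act_add w 0 0
  rw [h0] at h
  exact (neg_eq_of_add_eq_zero_right h.symm).symm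

/-- The action of the finite Weyl group on the weight lattice, written multiplicatively. -/
def actHom : FinWeyl →* MulAut (Multiplicative Weight) where
  toFun w :=
    { toFun := fun l => Multiplicative.ofAdd (act w l.toAdd)
      invFun := fun l => Multiplicative.ofAdd (act w⁻¹ l.toAdd)
      left_inv := fun l => by simp [← act_mul, act_one]
      right_inv := fun l => by simp [← act_mul, act_one]
      map_mul' := fun k l => by simp [act_add] }
  map_one' := by ext l : 1; simp [act_one]
  map_mul' v w := by ext l : 1; simp [act_mul]

/-! ### The extended affine Weyl group -/

/-- The extended affine Weyl group `W̃ = t_P ⋊ W̄`; the element with components `left = ν` and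
`right = w` is `t_ν w`. -/
abbrev ExtWeyl : Type := Multiplicative Weight ⋊[actHom] FinWeyl

/-- The inclusion of the finite Weyl group. -/
def fin (w : FinWeyl) : ExtWeyl := SemidirectProduct.inr w

/-- The horizontal projection `ȳ` of `y`. -/
def bar (y : ExtWeyl) : FinWeyl := y.right

/-- The weight `λ` in the unique expression `y = ȳ t_{-λ}`. -/
def lam (y : ExtWeyl) : Weight := -act (bar y)⁻¹ y.left.toAdd

/-- The affine Weyl group `W = t_Q ⋊ W̄` as a set of elements of `W̃`. -/
def affWeyl : Set ExtWeyl := {y | y.left.toAdd ∈ rootLattice}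

/-- `β + m δ` is a positive real root of the affine algebra. -/
def IsPosAffineRoot (β : Weight) (m : ℤ) : Prop :=
  (β ∈ posRoots ∧ m = 0) ∨ (β ∈ roots ∧ 0 < m)

/-- The dominant chamber: all `y` such that
`y(αᵢ) = ȳ(αᵢ) + ⟨λ, αᵢ⟩ δ`, `y = ȳ t_{-λ}`, is a positive real root for `i = 1, 2`. -/
def chamber : Set ExtWeyl :=
  {y | IsPosAffineRoot (act (bar y) root₁) (lam y).1 ∧
    IsPosAffineRoot (act (bar y) root₂) (lam y).2}

/-- The map `ι(ȳ t_{-λ}) = 3 λ + ȳ⁻¹(ρ) - ρ`. -/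
def iota (y : ExtWeyl) : Weight := (3 : ℤ) • lam y + act (bar y)⁻¹ rho - rho

/-! ### Characters -/

/-- The Kostant partition function: the number of ways to write `β` as a sum of positive
roots. -/
def kostant (β : Weight) : ℕ :=
  Nat.card {n : ℕ × ℕ × ℕ // n.1 • root₁ + n.2.1 • root₂ + n.2.2 • rootθ = β}

/-- The Verma module character of highest weight `y`, a formal series of elements of `W̃`:
the coefficient of `z` is `K_{ι(y) - ι(z)}` if `z y⁻¹ ∈ W`, and `0` otherwise. -/
def vermaChar (y z : ExtWeyl) : ℤ :=
  open scoped Classical in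
  if z * y⁻¹ ∈ affWeyl then (kostant (iota y - iota z) : ℤ) else 0

/-- The multiplicity `m^y_z`: the coefficient of `z` in the alternating sum of the Verma module
characters of highest weights `y w`, `w ∈ W̄`. -/
def mult (y z : ExtWeyl) : ℤ :=
  ∑ w : FinWeyl, (Equiv.Perm.sign w : ℤ) * vermaChar (y * fin w) z

/-! ### Finiteness of the weight diagrams -/

theorem kostant_eq (i j : ℤ) :
    (kostant (2 * i - j, 2 * j - i) : ℤ) = max 0 (min i j + 1) := by
  have key : ∀ n : ℕ × ℕ × ℕ,
      n.1 • root₁ + n.2.1 • root₂ + n.2.2 • rootθ = (2 * i - j, 2 * j - i) ↔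
        (n.1 : ℤ) + n.2.2 = i ∧ (n.2.1 : ℤ) + n.2.2 = j := by
    rintro ⟨a, b, c⟩
    simp [root₁, root₂, rootθ, Prod.ext_iff]
    omega
  have e : {n : ℕ × ℕ × ℕ // n.1 • root₁ + n.2.1 • root₂ + n.2.2 • rootθ =
      (2 * i - j, 2 * j - i)} ≃ Fin (min i j + 1).toNat :=
    { toFun := fun n => ⟨n.1.2.2, by
        have := (key n.1).1 n.2
        omega⟩
      invFun := fun c => ⟨((i - (c : ℕ)).toNat, (j - (c : ℕ)).toNat, (c : ℕ)), by
        rw [key]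
        have := c.2
        dsimp only
        omega⟩
      left_inv := by
        rintro ⟨⟨a, b, c⟩, h⟩
        have := (key _).1 h
        ext <;> dsimp only at this ⊢ <;> omega
      right_inv := fun c => by simp }
  rw [kostant, Nat.card_congr e, Nat.card_eq_fintype_card, Fintype.card_fin]
  omega

theorem act_cases (w : FinWeyl) : ∃ a b c : Fin 3, w⁻¹ 0 = a ∧ w⁻¹ 1 = b ∧ w⁻¹ 2 = c ∧
    a ≠ b ∧ a ≠ c ∧ b ≠ c :=
  ⟨_, _, _, rfl, rfl, rfl, by simp, by simp, by simp⟩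

theorem act_sub_dvd (w : FinWeyl) (l : Weight) :
    (3 : ℤ) ∣ (act w l).1 - (act w l).2 - (l.1 - l.2) := by
  obtain ⟨a, b, c, ha, hb, hc, h1, h2, h3⟩ := act_cases w
  simp only [act, ha, hb, hc]
  fin_cases a <;> fin_cases b <;> fin_cases c <;> simp [eps] at h1 h2 h3 ⊢ <;> omega

theorem mem_rootLattice (l : Weight) : l ∈ rootLattice ↔ (3 : ℤ) ∣ l.1 - l.2 := by
  rw [rootLattice, AddSubgroup.mem_closure_pair]
  constructor
  · rintro ⟨m, n, rfl⟩
    simp [root₁, root₂]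
    omega
  · intro h
    obtain ⟨c, hc⟩ := h
    refine ⟨l.2 + 2 * c, l.2 + c, ?_⟩
    ext <;> simp [root₁, root₂] <;> omega

theorem mul_fin_inv_mem (y z : ExtWeyl) (w : FinWeyl) :
    z * (y * fin w)⁻¹ ∈ affWeyl ↔ z * y⁻¹ ∈ affWeyl := by
  have h1 := act_sub_dvd (z * (y * fin w)⁻¹).right (y.left.toAdd)
  have h2 := act_sub_dvd (z * y⁻¹).right (y.left.toAdd)
  have e1 : (z * (y * fin w)⁻¹).left.toAdd =
      z.left.toAdd - act (z * (y * fin w)⁻¹).right y.left.toAdd := by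
    have hl : (y * fin w).left = y.left := by simp [fin]
    rw [SemidirectProduct.mul_left, SemidirectProduct.inv_left, hl]
    simp [actHom, act_mul, sub_eq_add_neg, act_neg]
  have e2 : (z * y⁻¹).left.toAdd = z.left.toAdd - act (z * y⁻¹).right y.left.toAdd := by
    simp [actHom, act_mul, sub_eq_add_neg, act_neg]
  simp only [affWeyl, Set.mem_ofPred_eq, mem_rootLattice, e1, e2, Prod.fst_sub, Prod.snd_sub]
  omega

theorem bar_mul_fin (y : ExtWeyl) (w : FinWeyl) : bar (y * fin w) = bar y * w := by
  simp [bar, fin]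

theorem iota_mul_fin (y : ExtWeyl) (w : FinWeyl) :
    iota (y * fin w) = act w⁻¹ (iota y + rho) - rho := by
  have hl : (y * fin w).left = y.left := by simp [fin]
  have hz : ∀ l : Weight, (3 : ℤ) • l = l + l + l := fun l => by ext <;> simp <;> ring
  simp only [iota, lam, bar_mul_fin, hl, mul_inv_rev, act_mul, hz, sub_add_cancel, act_add,
    act_neg]

theorem iota_dvd (y : ExtWeyl) : (3 : ℤ) ∣ (iota y).1 - (iota y).2 := by
  have h := act_sub_dvd (bar y)⁻¹ rho
  simp only [iota, rho, Prod.fst_sub, Prod.snd_sub, Prod.fst_add, Prod.snd_add, Prod.smul_fst,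
    Prod.smul_snd, smul_eq_mul] at h ⊢
  omega

theorem iota_right_injective : Function.Injective fun z : ExtWeyl => (iota z, z.right) := by
  intro y z h
  obtain ⟨h1, h2⟩ := Prod.mk.inj h
  have h3 : lam y = lam z := by
    simp only [iota, bar, h2, Prod.ext_iff, Prod.fst_sub, Prod.snd_sub, Prod.fst_add,
      Prod.snd_add, Prod.smul_fst, Prod.smul_snd, smul_eq_mul] at h1
    ext <;> omega
  have h4 := congrArg (act z.right) (neg_injective h3)
  simp only [bar, h2, ← act_mul, mul_inv_cancel, act_one] at h4
  exact SemidirectProduct.ext h4 h2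

theorem sum_finWeyl (f : FinWeyl → ℤ) :
    ∑ w, f w = f 1 + f (Equiv.swap 0 1) + f (Equiv.swap 1 2) + f (Equiv.swap 0 2) +
      f (Equiv.swap 0 1 * Equiv.swap 1 2) + f (Equiv.swap 1 2 * Equiv.swap 0 1) := by
  have h : (Finset.univ : Finset FinWeyl) = {1, Equiv.swap 0 1, Equiv.swap 1 2, Equiv.swap 0 2,
      Equiv.swap 0 1 * Equiv.swap 1 2, Equiv.swap 1 2 * Equiv.swap 0 1} := by decide
  rw [h]
  repeat rw [Finset.sum_insert (by decide)]
  rw [Finset.sum_singleton]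
  ring

theorem alternating_sum_eq_zero (a b i j N : ℤ) (hN : |a| + |b| ≤ N)
    (h : 4 * N < |i| ∨ 4 * N < |j|) :
    max 0 (min i j + 1) - max 0 (min (i - a) j + 1) - max 0 (min i (j - b) + 1)
      - max 0 (min (i - a - b) (j - a - b) + 1) + max 0 (min (i - a - b) (j - b) + 1)
      + max 0 (min (i - a) (j - a - b) + 1) = 0 := by
  rw [lt_abs, lt_abs] at h
  have ha := abs_le.1 (le_refl |a|)
  have hb := abs_le.1 (le_refl |b|)
  have zero : ∀ {p q : ℤ}, p < 0 ∨ q < 0 → max 0 (min p q + 1) = 0 := fun h => by omega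
  have right : ∀ {p q : ℤ}, q ≤ p → max 0 (min p q + 1) = max 0 (q + 1) := fun h => by omega
  have left : ∀ {p q : ℤ}, p ≤ q → max 0 (min p q + 1) = max 0 (p + 1) := fun h => by omega
  have pos : ∀ {p q : ℤ}, 0 ≤ p → 0 ≤ q → max 0 (min p q + 1) = min p q + 1 :=
    fun h h' => by omega
  by_cases h1 : i < -N ∨ j < -N
  · rw [zero (by omega), zero (by omega), zero (by omega), zero (by omega), zero (by omega),
      zero (by omega)]
    rfl
  rcases le_or_gt i N with h3 | h3
  · rw [left (by omega), left (by omega), left (by omega), left (by omega), left (by omega),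
      left (by omega)]
    ring
  rcases le_or_gt j N with h4 | h4
  · rw [right (by omega), right (by omega), right (by omega), right (by omega),
      right (by omega), right (by omega)]
    ring
  · rw [pos (by omega) (by omega), pos (by omega) (by omega), pos (by omega) (by omega),
      pos (by omega) (by omega), pos (by omega) (by omega), pos (by omega) (by omega)]
    omega

theorem vermaChar_mul_fin (y z : ExtWeyl) (w : FinWeyl) : vermaChar (y * fin w) z =
    open scoped Classical in
    if z * y⁻¹ ∈ affWeyl then (kostant (act w⁻¹ (iota y + rho) - rho - iota z) : ℤ) else 0 := by
  rw [vermaChar, iota_mul_fin]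
  by_cases h : z * y⁻¹ ∈ affWeyl
  · rw [if_pos h, if_pos ((mul_fin_inv_mem y z w).2 h)]
  · rw [if_neg h, if_neg (fun hc => h ((mul_fin_inv_mem y z w).1 hc))]

theorem mult_eq (y z : ExtWeyl) (i j : ℤ) (h : iota y - iota z = (2 * i - j, 2 * j - i))
    (hy : z * y⁻¹ ∈ affWeyl) (a b : ℤ) (hab : iota y + rho = (a, b)) :
    mult y z = max 0 (min i j + 1) - max 0 (min (i - a) j + 1) - max 0 (min i (j - b) + 1)
      - max 0 (min (i - a - b) (j - a - b) + 1) + max 0 (min (i - a - b) (j - b) + 1)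
      + max 0 (min (i - a) (j - a - b) + 1) := by
  have hz : iota z = (a - 1, b - 1) - (2 * i - j, 2 * j - i) := by
    have : iota y = (a - 1, b - 1) := by rw [eq_sub_of_add_eq hab]; rfl
    rw [← this, ← h]; abel
  have s1 : act (Equiv.swap 0 1)⁻¹ (a, b) = (-a, a + b) := by
    simp [act, eps, show Equiv.swap (0 : Fin 3) 1 2 = 2 by decide]
  have s2 : act (Equiv.swap 1 2)⁻¹ (a, b) = (a + b, -b) := by
    simp [act, eps, show Equiv.swap (1 : Fin 3) 2 0 = 0 by decide]
  have s3 : act (Equiv.swap 0 2)⁻¹ (a, b) = (-b, -a) := by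
    simp [act, eps, show Equiv.swap (0 : Fin 3) 2 1 = 1 by decide]
  have s4 : act (Equiv.swap 0 1 * Equiv.swap 1 2)⁻¹ (a, b) = (b, -a - b) := by
    simp [act, eps, show Equiv.swap (0 : Fin 3) 1 2 = 2 by decide,
      show Equiv.swap (1 : Fin 3) 2 0 = 0 by decide]
    ring
  have s5 : act (Equiv.swap 1 2 * Equiv.swap 0 1)⁻¹ (a, b) = (-a - b, a) := by
    simp [act, eps, show Equiv.swap (0 : Fin 3) 1 2 = 2 by decide,
      show Equiv.swap (1 : Fin 3) 2 0 = 0 by decide]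
    ring
  have t : ∀ (p q i' j' : ℤ), p - 1 - (a - 1 - (2 * i - j)) = 2 * i' - j' →
      q - 1 - (b - 1 - (2 * j - i)) = 2 * j' - i' →
      (kostant ((p, q) - rho - iota z) : ℤ) = max 0 (min i' j' + 1) := by
    intro p q i' j' h1 h2
    rw [← kostant_eq, hz]
    simp only [rho, Prod.mk_sub_mk, h1, h2]
  simp only [mult, vermaChar_mul_fin, if_pos hy, hab, sum_finWeyl, inv_one, act_one,
    s1, s2, s3, s4, s5]
  rw [t a b i j (by ring) (by ring), t _ _ (i - a) j (by ring) (by ring),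
    t _ _ i (j - b) (by ring) (by ring), t _ _ (i - a - b) (j - a - b) (by ring) (by ring),
    t _ _ (i - a) (j - a - b) (by ring) (by ring), t _ _ (i - a - b) (j - b) (by ring) (by ring)]
  simp
  ring

/-- Every weight diagram is finite. -/
theorem mult_support_finite (y : ExtWeyl) : (Function.support (mult y)).Finite := by
  set N : ℤ := |(iota y + rho).1| + |(iota y + rho).2| with hN
  refine Set.Finite.subset (Set.Finite.preimage (iota_right_injective.injOn)
    ((Set.finite_Icc (iota y - (12 * N, 12 * N)) (iota y + (12 * N, 12 * N))).prod
      (Set.finite_univ (α := FinWeyl)))) ?_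
  intro z hz
  have hz' : mult y z ≠ 0 := hz
  by_cases hy : z * y⁻¹ ∈ affWeyl
  · obtain ⟨i, j, hij⟩ : ∃ i j : ℤ, iota y - iota z = (2 * i - j, 2 * j - i) := by
      have h1 := iota_dvd y
      have h2 := iota_dvd z
      refine ⟨(2 * (iota y - iota z).1 + (iota y - iota z).2) / 3,
        ((iota y - iota z).1 + 2 * (iota y - iota z).2) / 3, ?_⟩
      ext <;> simp only [Prod.fst_sub, Prod.snd_sub] <;> omega
    have hm := mult_eq y z i j hij hy _ _ rfl
    have hb : ¬ (4 * N < |i| ∨ 4 * N < |j|) := fun hc =>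
      hz' (hm.trans (alternating_sum_eq_zero _ _ i j N hN.ge hc))
    push Not at hb
    have hi := abs_le.1 hb.1
    have hj := abs_le.1 hb.2
    have e1 := congrArg Prod.fst hij
    have e2 := congrArg Prod.snd hij
    simp only [Prod.fst_sub, Prod.snd_sub] at e1 e2
    simp only [Set.mem_preimage, Set.mem_prod, Set.mem_Icc, Set.mem_univ, and_true,
      Prod.le_def, Prod.fst_sub, Prod.snd_sub, Prod.fst_add, Prod.snd_add]
    omega
  · refine absurd ?_ hz'
    simp only [mult, vermaChar_mul_fin, if_neg hy, mul_zero, Finset.sum_const_zero]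

/-! ### The extended character ring -/

/-- The character `χ_y = ∑_z m^y_z z`, an element of the group ring `ℤ[W̃]`. -/
def character (y : ExtWeyl) : MonoidAlgebra ℤ ExtWeyl :=
  MonoidAlgebra.ofCoeff (Finsupp.ofSupportFinite (mult y) (mult_support_finite y))

/-- The extended character ring: the subring of `ℤ[W̃]` generated by the characters `χ_y` with
`y` in the dominant chamber. -/
def characterRing : Subring (MonoidAlgebra ℤ ExtWeyl) :=
  Subring.closure (character '' chamber)

end ExtChar

end

/-!
The map `iota` is a cocycle, `iota (y z) = iota z + z̄⁻¹ (iota y)`, since `iota y + ρ` is three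
times the barycentre `y⁻¹ (ρ / 3)` of an alcove. Together with the class in `W̃ / W ≅ ℤ / 3` it determines
`y` (`eq_of_iota_eq`), and `y` lies in the chamber exactly when `iota y` is dominant
(`mem_chamber`).

Extend `y ↦ χ_y` linearly to a map `χ` of the group ring. The elements `f` with the product formula
`f χ_g = χ_{f g}` for all `g` form a subring, `productRing`. It contains
* the elements of length zero,
* the sum of the three simple reflections of the affine Weyl group, and
* the orbit sums of the translations by fundamental weights.

Each of these already satisfies the formula on characters of Verma modules; for the sum of the
simple reflections this reduces to the fact that the Weyl denominator times the generating series
of the Kostant partition function is a monomial (`kostant_hexagon`). By induction on the size of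
`iota y + ρ`, all characters lie in `productRing` (`character_mem_productRing`), and as `χ_1 = 1`,
every element `f` of this ring is `χ_f`, a combination of characters of the chamber. So the
characters of the chamber span the character ring.

The functional `f ↦ ∑_w det(w) f(z w)` takes the value `δ_{y,z}` both on `χ_y` and on `y`, for `y`
and `z` in the chamber. Hence the characters of the chamber are linearly independent, and the
product formula gives the structure constants `∑_w det(w) m^x_{z w y⁻¹}`
(`coordinate_character_mul`). By the cocycle property these are the numbers
`∑_w det(w) m^{ι(x)}(w (ι(z) + ρ) - ρ - ι(y))`, that is, the multiplicities of `V(ι(z))` in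
`V(ι(x)) ⊗ V(ι(y))` for `sl(3)`. They are nonnegative by a direct computation with the closed
formula `mult_eq_max` for the weight multiplicities of `sl(3)`.
-/

namespace ExtChar

/-! ### The finite Weyl group on weights -/

theorem finWeyl_cases (w : FinWeyl) : w = 1 ∨ w = Equiv.swap 0 1 ∨ w = Equiv.swap 1 2 ∨
    w = Equiv.swap 0 2 ∨ w = Equiv.swap 0 1 * Equiv.swap 1 2 ∨
    w = Equiv.swap 1 2 * Equiv.swap 0 1 := by
  revert w
  decide

theorem act_sub (w : FinWeyl) (k l : Weight) : act w (k - l) = act w k - act w l := by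
  rw [sub_eq_add_neg, act_add, act_neg, ← sub_eq_add_neg]

theorem act_zsmul (w : FinWeyl) (n : ℤ) (l : Weight) : act w (n • l) = n • act w l :=
  (AddMonoidHom.mk' (act w) (act_add w)).map_zsmul n l

theorem act_inv_act (w : FinWeyl) (l : Weight) : act w⁻¹ (act w l) = l := by
  rw [← act_mul, inv_mul_cancel, act_one]

theorem act_swap_zero_one (l : Weight) :
    act (Equiv.swap 0 1) l = (-l.1, l.1 + l.2) := by
  ext <;> simp [act, eps, show Equiv.swap (0 : Fin 3) 1 2 = 2 by decide]

theorem act_swap_one_two (l : Weight) :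
    act (Equiv.swap 1 2) l = (l.1 + l.2, -l.2) := by
  ext <;> simp [act, eps, show Equiv.swap (1 : Fin 3) 2 0 = 0 by decide]

theorem act_swap_zero_two (l : Weight) :
    act (Equiv.swap 0 2) l = (-l.2, -l.1) := by
  ext <;> simp [act, eps, show Equiv.swap (0 : Fin 3) 2 1 = 1 by decide]

theorem act_swap_mul_swap (l : Weight) :
    act (Equiv.swap 0 1 * Equiv.swap 1 2) l = (-l.1 - l.2, l.1) := by
  rw [act_mul, act_swap_one_two, act_swap_zero_one]
  ext <;> simp; ring

theorem act_swap_mul_swap' (l : Weight) :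
    act (Equiv.swap 1 2 * Equiv.swap 0 1) l = (l.2, -l.1 - l.2) := by
  rw [act_mul, act_swap_zero_one, act_swap_one_two]
  ext <;> simp; ring

theorem act_cases_weight (w : FinWeyl) (l : Weight) :
    act w l = l ∨ act w l = (l.2, -l.1 - l.2) ∨ act w l = (-l.1 - l.2, l.1) ∨
      act w l = (-l.1, l.1 + l.2) ∨ act w l = (l.1 + l.2, -l.2) ∨ act w l = (-l.2, -l.1) := by
  rcases finWeyl_cases w with h | h | h | h | h | h <;> subst h
  · simp only [act_one, true_or]
  · simp only [act_swap_zero_one, true_or, or_true]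
  · simp only [act_swap_one_two, true_or, or_true]
  · simp only [act_swap_zero_two, or_true]
  · simp only [act_swap_mul_swap, true_or, or_true]
  · simp only [act_swap_mul_swap', true_or, or_true]

/-- The weights `ε₀ = ϖ₁`, `ε₁ = ϖ₂ - ϖ₁`, `ε₂ = -ϖ₂` of the vector representation. -/
def epsWeight : Fin 3 → Weight := ![(1, 0), (-1, 1), (0, -1)]

theorem act_epsWeight (w : FinWeyl) (k : Fin 3) : act w (epsWeight k) = epsWeight (w k) := by
  revert w k
  decide

theorem sum_act_epsWeight (w : FinWeyl) (f : Weight → ℤ) :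
    ∑ k, f (act w (epsWeight k)) = ∑ k, f (epsWeight k) := by
  simp only [act_epsWeight]
  exact Equiv.sum_comp w fun k => f (epsWeight k)

/-- The highest root and the negatives of the simple roots. They are the values of `iota` at the
simple reflections of the affine Weyl group. -/
def affRoot (k : Fin 3) : Weight := epsWeight k - epsWeight (k - 1)

theorem sum_act_affRoot (w : FinWeyl) (f : Weight → ℤ) :
    (Equiv.Perm.sign w = 1 ∧ ∑ k, f (act w (affRoot k)) = ∑ k, f (affRoot k)) ∨
    (Equiv.Perm.sign w = -1 ∧ ∑ k, f (act w (affRoot k)) = ∑ k, f (-affRoot k)) := by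
  -- Even `w` permute the three weights, odd `w` map them to their negatives.
  have key : ∀ w : FinWeyl,
      (Equiv.Perm.sign w = 1 ∧ ∃ v : FinWeyl, ∀ k, act w (affRoot k) = affRoot (v k)) ∨
      (Equiv.Perm.sign w = -1 ∧ ∃ v : FinWeyl, ∀ k, act w (affRoot k) = -affRoot (v k)) := by
    decide
  obtain ⟨hs, v, hv⟩ | ⟨hs, v, hv⟩ := key w
  · exact Or.inl ⟨hs, by simp only [hv]; exact Equiv.sum_comp v fun k => f (affRoot k)⟩
  · exact Or.inr ⟨hs, by simp only [hv]; exact Equiv.sum_comp v fun k => f (-affRoot k)⟩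

theorem act_rho_sub_dvd (v w : FinWeyl) (h : Equiv.Perm.sign v = Equiv.Perm.sign w) :
    (3 : ℤ) ∣ (act v⁻¹ rho - act w⁻¹ rho).1 ∧ (3 : ℤ) ∣ (act v⁻¹ rho - act w⁻¹ rho).2 := by
  revert v w
  decide

/-- The product of the Weyl denominator with the generating series of the Kostant partition
function is a monomial, whose exponent does not lie in `3 P`. -/
theorem kostant_hexagon (β : Weight) (h1 : (3 : ℤ) ∣ β.1) (h2 : (3 : ℤ) ∣ β.2) :
    ∑ k, (kostant (β + affRoot k) : ℤ) = ∑ k, (kostant (β + -affRoot k) : ℤ) := by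
  obtain ⟨⟨p, hp⟩, ⟨q, hq⟩⟩ := h1, h2
  have key : ∀ (γ : Weight) (i j : ℤ), γ = (2 * i - j, 2 * j - i) →
      (kostant γ : ℤ) = max 0 (min i j + 1) := fun γ i j h => h ▸ kostant_eq i j
  have hβ : β = (3 * p, 3 * q) := Prod.ext hp hq
  simp only [Fin.sum_univ_three, hβ]
  rw [key _ (2 * p + q + 1) (p + 2 * q + 1), key _ (2 * p + q - 1) (p + 2 * q),
    key _ (2 * p + q) (p + 2 * q - 1), key _ (2 * p + q - 1) (p + 2 * q - 1),
    key _ (2 * p + q + 1) (p + 2 * q), key _ (2 * p + q) (p + 2 * q + 1)]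
  · omega
  all_goals
    ext <;> simp [affRoot, epsWeight] <;> ring

/-! ### The map iota and the alcoves -/

/-- The class of `y` in `W̃ / W ≅ P / Q ≅ ℤ / 3`. -/
def latticeClass : ExtWeyl →* Multiplicative (ZMod 3) where
  toFun y := Multiplicative.ofAdd ((y.left.toAdd.1 - y.left.toAdd.2 : ℤ) : ZMod 3)
  map_one' := by simp
  map_mul' y z := by
    rw [← ofAdd_add, ← Int.cast_add]
    congr 1
    rw [← sub_eq_zero, ← Int.cast_sub, ZMod.intCast_zmod_eq_zero_iff_dvd]
    have h := act_sub_dvd y.right z.left.toAdd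
    have e : (y * z).left.toAdd = y.left.toAdd + act y.right z.left.toAdd := by
      simp [actHom]
    rw [e, Prod.fst_add, Prod.snd_add]
    push_cast
    omega

theorem latticeClass_eq_one (y : ExtWeyl) : latticeClass y = 1 ↔ y ∈ affWeyl := by
  simp only [affWeyl, Set.mem_ofPred_eq, mem_rootLattice]
  exact ZMod.intCast_zmod_eq_zero_iff_dvd _ 3

theorem mul_inv_mem_affWeyl (z y : ExtWeyl) :
    z * y⁻¹ ∈ affWeyl ↔ latticeClass z = latticeClass y := by
  rw [← latticeClass_eq_one, map_mul, map_inv, mul_inv_eq_one]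

theorem latticeClass_fin (w : FinWeyl) : latticeClass (fin w) = 1 := by
  simp [latticeClass, fin]

theorem bar_mul (y z : ExtWeyl) : bar (y * z) = bar y * bar z := rfl

theorem bar_inv (y : ExtWeyl) : bar y⁻¹ = (bar y)⁻¹ := rfl

/-- `iota` is a cocycle: `iota y + ρ = 3 y⁻¹(ρ / 3)` for the affine action of `W̃`. -/
theorem iota_mul (y z : ExtWeyl) : iota (y * z) = iota z + act (bar z)⁻¹ (iota y) := by
  have e : (y * z).left.toAdd = y.left.toAdd + act (bar y) z.left.toAdd := by
    simp [actHom, bar]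
  simp only [iota, lam, bar_mul, e, mul_inv_rev, act_mul, act_add, act_sub, act_neg, act_zsmul,
    act_inv_act, neg_add, smul_add]
  abel

theorem iota_one : iota 1 = 0 := by
  simp [iota, lam, bar, act_one]

theorem iota_inv (y : ExtWeyl) : iota y⁻¹ = -act (bar y) (iota y) := by
  have h := iota_mul y y⁻¹
  rw [mul_inv_cancel, iota_one, bar_inv, inv_inv] at h
  exact (neg_eq_of_add_eq_zero_left h.symm).symm

theorem iota_mul_inv (z y : ExtWeyl) : iota (z * y⁻¹) = act (bar y) (iota z - iota y) := by
  rw [iota_mul, iota_inv, bar_inv, inv_inv, act_sub]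
  abel

theorem iota_sub_dvd (y g : ExtWeyl) (h : Equiv.Perm.sign (bar y) = Equiv.Perm.sign (bar g)) :
    (3 : ℤ) ∣ (iota y - iota g).1 ∧ (3 : ℤ) ∣ (iota y - iota g).2 := by
  have := act_rho_sub_dvd _ _ h
  simp only [iota, Prod.fst_sub, Prod.snd_sub, Prod.fst_add, Prod.snd_add, Prod.smul_fst,
    Prod.smul_snd, smul_eq_mul] at this ⊢
  omega

theorem eq_one_of_iota_eq_zero (y : ExtWeyl) (h : iota y = 0) (hy : latticeClass y = 1) :
    y = 1 := by
  rw [latticeClass_eq_one, affWeyl, Set.mem_ofPred_eq, mem_rootLattice] at hy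
  have hc := act_sub_dvd (bar y)⁻¹ y.left.toAdd
  have h1 := congrArg Prod.fst h
  have h2 := congrArg Prod.snd h
  have key : ∀ w : FinWeyl, w = 1 ∨
      ¬ ((3 : ℤ) ∣ (act w⁻¹ rho).1 - 1 ∧ (3 : ℤ) ∣ (act w⁻¹ rho).2 - 1 ∧
        (9 : ℤ) ∣ (act w⁻¹ rho).1 - (act w⁻¹ rho).2) := by decide
  simp only [iota, lam, rho, Prod.fst_sub, Prod.snd_sub, Prod.fst_add, Prod.snd_add,
    Prod.smul_fst, Prod.smul_snd, smul_eq_mul, Prod.fst_zero, Prod.snd_zero, Prod.fst_neg,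
    Prod.snd_neg] at h1 h2
  have hb : bar y = 1 := by
    refine (key (bar y)).resolve_right fun hn => hn ?_
    rw [show rho = (1, 1) from rfl]
    omega
  apply iota_right_injective
  have : y.right = 1 := hb
  simp [h, iota_one, this]

theorem eq_of_iota_eq {y z : ExtWeyl} (h : iota y = iota z)
    (hc : latticeClass y = latticeClass z) : y = z := by
  rw [← mul_inv_eq_one]
  apply eq_one_of_iota_eq_zero
  · rw [iota_mul_inv, h, sub_self, ← sub_self (0 : Weight), act_sub, sub_self, sub_self]
  · rw [map_mul, map_inv, hc, mul_inv_cancel]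

theorem act_root_mem (w : FinWeyl) :
    (act w root₁ ∈ posRoots ↔ 0 < (act w⁻¹ rho).1) ∧
      (act w root₂ ∈ posRoots ↔ 0 < (act w⁻¹ rho).2) ∧
      act w root₁ ∈ roots ∧ act w root₂ ∈ roots := by
  simp only [posRoots, roots, Set.mem_insert_iff, Set.mem_singleton_iff, Set.mem_ofPred_eq]
  revert w
  decide

theorem act_rho_bounds (w : FinWeyl) : -2 ≤ (act w⁻¹ rho).1 ∧ (act w⁻¹ rho).1 ≤ 2 ∧
    -2 ≤ (act w⁻¹ rho).2 ∧ (act w⁻¹ rho).2 ≤ 2 ∧ (act w⁻¹ rho).1 ≠ 0 ∧ (act w⁻¹ rho).2 ≠ 0 := by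
  revert w
  decide

theorem mem_chamber (y : ExtWeyl) : y ∈ chamber ↔ 0 ≤ (iota y).1 ∧ 0 ≤ (iota y).2 := by
  obtain ⟨h1, h2, h3, h4⟩ := act_root_mem (bar y)
  have hb := act_rho_bounds (bar y)
  simp only [chamber, IsPosAffineRoot, Set.mem_ofPred_eq, h1, h2, h3, h4, true_and]
  simp only [iota, Prod.fst_sub, Prod.snd_sub, Prod.fst_add, Prod.snd_add, Prod.smul_fst,
    Prod.smul_snd, smul_eq_mul]
  simp only [rho] at hb ⊢
  omega

/-- `iota y + ρ`, three times the barycentre of the alcove `y⁻¹ A₀`, lies on no wall. -/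
theorem iota_add_rho_ne (y : ExtWeyl) : ¬ (3 : ℤ) ∣ (iota y).1 + 1 ∧ ¬ (3 : ℤ) ∣ (iota y).2 + 1 ∧
    ¬ (3 : ℤ) ∣ (iota y).1 + (iota y).2 + 2 := by
  have key : ∀ w : FinWeyl, ¬ (3 : ℤ) ∣ (act w⁻¹ rho).1 ∧ ¬ (3 : ℤ) ∣ (act w⁻¹ rho).2 ∧
    ¬ (3 : ℤ) ∣ (act w⁻¹ rho).1 + (act w⁻¹ rho).2 := by decide
  have hb := key (bar y)
  simp only [iota, Prod.fst_sub, Prod.snd_sub, Prod.fst_add, Prod.snd_add, Prod.smul_fst,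
    Prod.smul_snd, smul_eq_mul]
  simp only [rho] at hb ⊢
  omega

theorem exists_mul_fin_mem_chamber (y : ExtWeyl) : ∃ w : FinWeyl, y * fin w ∈ chamber := by
  have h := iota_add_rho_ne y
  have hk : ∀ w : FinWeyl, (y * fin w⁻¹ ∈ chamber ↔
      0 < (act w (iota y + rho)).1 ∧ 0 < (act w (iota y + rho)).2) := fun w => by
    rw [mem_chamber, iota_mul_fin, inv_inv]
    simp only [rho, Prod.fst_sub, Prod.snd_sub]
    omega
  by_contra! hn
  have h0 := mt (hk 1).2 (hn _)
  have h1 := mt (hk (Equiv.swap 0 1)).2 (hn _)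
  have h2 := mt (hk (Equiv.swap 1 2)).2 (hn _)
  have h3 := mt (hk (Equiv.swap 0 2)).2 (hn _)
  have h4 := mt (hk (Equiv.swap 0 1 * Equiv.swap 1 2)).2 (hn _)
  have h5 := mt (hk (Equiv.swap 1 2 * Equiv.swap 0 1)).2 (hn _)
  rw [act_one] at h0
  rw [act_swap_zero_one] at h1
  rw [act_swap_one_two] at h2
  rw [act_swap_zero_two] at h3
  rw [act_swap_mul_swap] at h4
  rw [act_swap_mul_swap'] at h5
  simp only [Prod.fst_add, Prod.snd_add, rho] at *
  omega

/-- The largest absolute value of `⟨λ, α⟩` over the roots `α`. -/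
def radius (l : Weight) : ℤ := max |l.1| (max |l.2| |l.1 + l.2|)

theorem radius_lt (l : Weight) (m : ℤ) : radius l < m ↔
    (-m < l.1 ∧ l.1 < m) ∧ (-m < l.2 ∧ l.2 < m) ∧ -m < l.1 + l.2 ∧ l.1 + l.2 < m := by
  simp only [radius, max_lt_iff, abs_lt]

theorem radius_of_nonneg (l : Weight) (h₁ : 0 ≤ l.1) (h₂ : 0 ≤ l.2) : radius l = l.1 + l.2 := by
  simp only [radius, abs_of_nonneg, h₁, h₂, add_nonneg]
  omega

theorem radius_act (w : FinWeyl) (l : Weight) : radius (act w l) = radius l := by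
  rcases act_cases_weight w l with h | h | h | h | h | h <;> rw [h] <;>
    simp only [radius, abs_eq_max_neg] <;> omega

theorem radius_iota_mul_fin (y : ExtWeyl) (w : FinWeyl) :
    radius (iota (y * fin w) + rho) = radius (iota y + rho) := by
  rw [iota_mul_fin, sub_add_cancel, radius_act]

/-! ### Characters as a linear map and the product formula -/

theorem coeff_character (y z : ExtWeyl) : (character y).coeff z = mult y z := rfl

theorem fin_mul (v w : FinWeyl) : fin (v * w) = fin v * fin w := map_mul SemidirectProduct.inr v w

theorem mult_mul_fin (y z : ExtWeyl) (w : FinWeyl) :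
    mult (y * fin w) z = Equiv.Perm.sign w * mult y z := by
  rw [mult, mult, Finset.mul_sum, ← Equiv.sum_comp (Equiv.mulLeft w⁻¹)]
  refine Finset.sum_congr rfl fun v _ => ?_
  rw [Equiv.coe_mulLeft, mul_assoc, ← fin_mul, mul_inv_cancel_left, Equiv.Perm.sign_mul,
    Equiv.Perm.sign_inv, Units.val_mul, mul_assoc]

theorem character_mul_fin (y : ExtWeyl) (w : FinWeyl) :
    character (y * fin w) = (Equiv.Perm.sign w : ℤ) • character y := by
  ext z
  exact mult_mul_fin y z w

/-- The `ℤ`-linear endomorphism of the group ring with `y ↦ χ_y`. -/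
noncomputable def charMap : MonoidAlgebra ℤ ExtWeyl →ₗ[ℤ] MonoidAlgebra ℤ ExtWeyl :=
  (Finsupp.linearCombination ℤ character).comp (MonoidAlgebra.coeffLinearEquiv ℤ).toLinearMap

theorem charMap_single (y : ExtWeyl) : charMap (MonoidAlgebra.single y 1) = character y := by
  simp [charMap]

/-- The elements `f` of the group ring with the product formula `f χ_g = χ_{f g}`, where `χ` is
extended linearly to the group ring. -/
noncomputable def productRing : Subring (MonoidAlgebra ℤ ExtWeyl) where
  carrier := {f | ∀ g, f * charMap g = charMap (f * g)}
  mul_mem' {a b} ha hb g := by rw [mul_assoc, hb, ha, mul_assoc]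
  one_mem' g := by rw [one_mul, one_mul]
  add_mem' {a b} ha hb g := by rw [add_mul, add_mul, map_add, ha, hb]
  zero_mem' g := by rw [zero_mul, zero_mul, map_zero]
  neg_mem' {a} ha g := by rw [neg_mul, neg_mul, map_neg, ha]

theorem mul_charMap {f : MonoidAlgebra ℤ ExtWeyl} (hf : f ∈ productRing)
    (g : MonoidAlgebra ℤ ExtWeyl) : f * charMap g = charMap (f * g) := hf g

theorem mem_productRing {f : MonoidAlgebra ℤ ExtWeyl}
    (hf : ∀ y, f * character y = charMap (f * MonoidAlgebra.single y 1)) : f ∈ productRing := by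
  intro g
  induction g using MonoidAlgebra.induction_linear with
  | zero => simp
  | add a b ha hb => rw [map_add, mul_add, mul_add, map_add, ha, hb]
  | single y n =>
    have e : (MonoidAlgebra.single y n : MonoidAlgebra ℤ ExtWeyl)
        = n • MonoidAlgebra.single y 1 := by simp
    rw [e, map_smul, mul_smul_comm, mul_smul_comm, map_smul, charMap_single, hf]

/-- It is enough to check the product formula on characters of Verma modules. -/
theorem sum_single_mem_productRing {ι : Type*} [Fintype ι] (t : ι → ExtWeyl)
    (h : ∀ y g, ∑ k, vermaChar y ((t k)⁻¹ * g) = ∑ k, vermaChar (t k * y) g) :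
    ∑ k, MonoidAlgebra.single (t k) (1 : ℤ) ∈ productRing := by
  refine mem_productRing fun y => ?_
  simp only [Finset.sum_mul, MonoidAlgebra.single_mul_single, map_sum, mul_one, charMap_single]
  ext g
  simp only [MonoidAlgebra.coeff_sum, Finsupp.finsetSum_apply,
    MonoidAlgebra.coeff_single_mul_apply, one_mul, coeff_character, mult]
  rw [Finset.sum_comm, Finset.sum_comm (γ := ι)]
  refine Finset.sum_congr rfl fun w _ => ?_
  rw [← Finset.mul_sum, ← Finset.mul_sum, h]
  simp only [mul_assoc]

theorem vermaChar_eq (y z : ExtWeyl) : vermaChar y z =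
    if latticeClass z = latticeClass y then (kostant (iota y - iota z) : ℤ) else 0 := by
  classical
  simp only [vermaChar, mul_inv_mem_affWeyl]

/-- The criterion of `sum_single_mem_productRing` for elements `t k` in one coset of `W`. -/
theorem sum_single_mem_productRing' {ι : Type*} [Fintype ι] (t : ι → ExtWeyl)
    (c : Multiplicative (ZMod 3)) (hc : ∀ k, latticeClass (t k) = c)
    (h : ∀ y g : ExtWeyl,
      ∑ k, (kostant (iota y - iota g + act (bar g)⁻¹ (act (bar (t k)) (iota (t k)))) : ℤ) =
        ∑ k, (kostant (iota y - iota g + act (bar y)⁻¹ (iota (t k))) : ℤ)) :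
    ∑ k, MonoidAlgebra.single (t k) (1 : ℤ) ∈ productRing := by
  refine sum_single_mem_productRing t fun y g => ?_
  simp only [vermaChar_eq, map_mul, map_inv, hc, iota_mul, iota_inv, act_neg, inv_mul_eq_iff_eq_mul]
  by_cases hg : latticeClass g = c * latticeClass y
  · simp only [if_pos hg]
    convert h y g using 4 <;> abel
  · simp only [if_neg hg]

/-- The elements `ω` with `iota ω = 0` are those of length zero, which fix the fundamental
alcove. -/
theorem single_mem_productRing (ω : ExtWeyl) (h : iota ω = 0) :
    MonoidAlgebra.single ω (1 : ℤ) ∈ productRing := by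
  have := sum_single_mem_productRing' (fun _ : Unit => ω) _ (fun _ => rfl) (fun y g => by
    have h0 : ∀ w : FinWeyl, act w 0 = 0 := fun w => by simpa using act_sub w 0 0
    simp [h, h0])
  simpa using this

/-- The simple reflections of the affine Weyl group; `0` is the index of the affine one. -/
def simpleRefl (k : Fin 3) : ExtWeyl :=
  ⟨Multiplicative.ofAdd (if k = 0 then (1, 1) else 0), Equiv.swap k (k - 1)⟩

theorem iota_simpleRefl (k : Fin 3) : iota (simpleRefl k) = affRoot k := by
  revert k
  decide

theorem bar_simpleRefl (k : Fin 3) : act (bar (simpleRefl k)) (affRoot k) = -affRoot k := by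
  revert k
  decide

theorem latticeClass_simpleRefl (k : Fin 3) : latticeClass (simpleRefl k) = 1 := by
  revert k
  decide

theorem sum_simpleRefl_mem_productRing :
    ∑ k, MonoidAlgebra.single (simpleRefl k) (1 : ℤ) ∈ productRing := by
  refine sum_single_mem_productRing' _ 1 latticeClass_simpleRefl fun y g => ?_
  simp only [iota_simpleRefl, bar_simpleRefl, act_neg]
  set β := iota y - iota g with hβ
  have hg := sum_act_affRoot (bar g)⁻¹ fun v => (kostant (β + -v) : ℤ)
  have hy := sum_act_affRoot (bar y)⁻¹ fun v => (kostant (β + v) : ℤ)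
  simp only [Equiv.Perm.sign_inv, neg_neg] at hg hy
  -- If `y` and `g` have the same parity then `iota y - iota g` lies in `3 P`.
  have hx : Equiv.Perm.sign (bar y) = Equiv.Perm.sign (bar g) →
      ∑ k, (kostant (β + affRoot k) : ℤ) = ∑ k, (kostant (β + -affRoot k) : ℤ) := fun h =>
    kostant_hexagon β (iota_sub_dvd y g h).1 (iota_sub_dvd y g h).2
  rcases hg with ⟨h1, h2⟩ | ⟨h1, h2⟩ <;> rcases hy with ⟨h3, h4⟩ | ⟨h3, h4⟩ <;> rw [h2, h4]
  · exact (hx (h3.trans h1.symm)).symm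
  · exact hx (h3.trans h1.symm)

/-- The translation `t_{-λ}`. -/
def trans (l : Weight) : ExtWeyl := ⟨Multiplicative.ofAdd (-l), 1⟩

theorem iota_trans (l : Weight) : iota (trans l) = (3 : ℤ) • l := by
  simp [iota, lam, bar, trans, act_one]

theorem sum_trans_mem_productRing (s : ℤ) :
    ∑ k, MonoidAlgebra.single (trans (s • epsWeight k)) (1 : ℤ) ∈ productRing := by
  have hc : ∀ k, latticeClass (trans (s • epsWeight k)) = latticeClass (trans (s • (1, 0))) := by
    intro k
    simp only [latticeClass, trans, MonoidHom.coe_mk, OneHom.coe_mk]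
    congr 1
    rw [← sub_eq_zero, ← Int.cast_sub, ZMod.intCast_zmod_eq_zero_iff_dvd]
    fin_cases k <;> simp [epsWeight]; omega
  refine sum_single_mem_productRing' _ _ hc fun y g => ?_
  have hb : ∀ l, bar (trans l) = 1 := fun l => rfl
  simp only [iota_trans, hb, act_one, act_zsmul]
  exact (sum_act_epsWeight _ fun v =>
      (kostant (iota y - iota g + (3 : ℤ) • s • v) : ℤ)).trans
    (sum_act_epsWeight _ fun v => (kostant (iota y - iota g + (3 : ℤ) • s • v) : ℤ)).symm

theorem sum_trans_mul_character (s : ℤ) (y : ExtWeyl) :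
    (∑ k, MonoidAlgebra.single (trans (s • epsWeight k)) (1 : ℤ)) * character y =
      ∑ k, character (trans (s • epsWeight k) * y) := by
  rw [← charMap_single, mul_charMap (sum_trans_mem_productRing s)]
  simp [Finset.sum_mul, MonoidAlgebra.single_mul_single, charMap_single]

/-! ### Closed formulas for alternating sums -/

/-- Kostant's multiplicity formula for the weight `(t₀ - t₁, t₁ - t₂)` of the module of highest
weight `(a, b)`, in closed form. The right-hand side counts the vectors `x` in `ℕ³` with `x + t`
in `ℕ³` and `x₀ + x₁ + x₂ = b`, minus those with `x₀ + x₁ + x₂ = b - 1`; this is the multiplicity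
in `Sym^a V ⊗ Sym^b V*` minus that in `Sym^(a-1) V ⊗ Sym^(b-1) V*`. -/
theorem kostant_alternating_sum (a b t₀ t₁ t₂ : ℤ) (ha : 0 ≤ a) (hb : 0 ≤ b)
    (ht : t₀ + t₁ + t₂ = a - b) :
    max 0 (min (a - t₀) (b + t₂) + 1) - max 0 (min (a - t₀ - (a + 1)) (b + t₂) + 1)
      - max 0 (min (a - t₀) (b + t₂ - (b + 1)) + 1)
      - max 0 (min (a - t₀ - (a + 1) - (b + 1)) (b + t₂ - (a + 1) - (b + 1)) + 1)
      + max 0 (min (a - t₀ - (a + 1) - (b + 1)) (b + t₂ - (b + 1)) + 1)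
      + max 0 (min (a - t₀ - (a + 1)) (b + t₂ - (a + 1) - (b + 1)) + 1)
      = max 0 (1 + b - (max 0 (-t₀) + max 0 (-t₁) + max 0 (-t₂))) := by
  obtain rfl : t₁ = a - b - t₀ - t₂ := by omega
  have left : ∀ {x y : ℤ}, x ≤ y → min x y = x := fun h => min_eq_left h
  have right : ∀ {x y : ℤ}, y ≤ x → min x y = y := fun h => min_eq_right h
  rcases le_total (a - t₀) (b + t₂) with h | h
  · rw [left h, left (by omega : a - t₀ - (a + 1) ≤ b + t₂),
      left (by omega : a - t₀ - (a + 1) - (b + 1) ≤ b + t₂ - (b + 1)),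
      left (by omega : a - t₀ - (a + 1) - (b + 1) ≤ b + t₂ - (a + 1) - (b + 1))]
    rcases le_total (a - t₀) (b + t₂ - (b + 1)) with h' | h'
    · rw [left h', left (by omega)]
      omega
    · rw [right h', right (by omega)]
      omega
  · rw [right h, right (by omega : b + t₂ - (b + 1) ≤ a - t₀),
      right (by omega : b + t₂ - (a + 1) - (b + 1) ≤ a - t₀ - (a + 1)),
      right (by omega : b + t₂ - (a + 1) - (b + 1) ≤ a - t₀ - (a + 1) - (b + 1))]
    rcases le_total (a - t₀ - (a + 1)) (b + t₂) with h' | h'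
    · rw [left h', left (by omega)]
      omega
    · rw [right h', right (by omega)]
      omega

/-- For `c = b + 1` the sum is the coefficient of `q ^ b` in `(1 - q)⁻²` times the determinant of
the matrix `q ^ max 0 (uᵢ - nⱼ)`. It vanishes unless `u` and `n` interlace, in
which case it is a second difference of the convex function `x ↦ max 0 (c - x)`. -/
theorem signed_sum_nonneg (c u₀ u₁ u₂ n₀ n₁ n₂ : ℤ) (hu₀ : u₁ < u₀) (hu₁ : u₂ < u₁)
    (hn₀ : n₁ < n₀) (hn₁ : n₂ < n₁) :
    0 ≤ max 0 (c - (max 0 (u₀ - n₀) + max 0 (u₁ - n₁) + max 0 (u₂ - n₂)))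
      - max 0 (c - (max 0 (u₀ - n₁) + max 0 (u₁ - n₀) + max 0 (u₂ - n₂)))
      - max 0 (c - (max 0 (u₀ - n₀) + max 0 (u₁ - n₂) + max 0 (u₂ - n₁)))
      - max 0 (c - (max 0 (u₀ - n₂) + max 0 (u₁ - n₁) + max 0 (u₂ - n₀)))
      + max 0 (c - (max 0 (u₀ - n₁) + max 0 (u₁ - n₂) + max 0 (u₂ - n₀)))
      + max 0 (c - (max 0 (u₀ - n₂) + max 0 (u₁ - n₀) + max 0 (u₂ - n₁))) := by
  have left : ∀ {x y : ℤ}, x ≤ y → max 0 (x - y) = 0 := fun h => by omega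
  have right : ∀ {x y : ℤ}, y < x → max 0 (x - y) = x - y := fun h => by omega
  -- Run through the relative orders of the `u`'s and `n`'s.
  rcases le_or_gt u₀ n₀ with h | h <;> rcases le_or_gt u₀ n₁ with h' | h' <;>
    first
    | (exfalso; omega)
    | (rcases le_or_gt u₀ n₂ with h₀ | h₀ <;> rcases le_or_gt u₁ n₀ with h₁ | h₁ <;>
        rcases le_or_gt u₁ n₁ with h₂ | h₂ <;>
        first
        | (exfalso; omega)
        | (rcases le_or_gt u₁ n₂ with h₃ | h₃ <;> rcases le_or_gt u₂ n₀ with h₄ | h₄ <;>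
            rcases le_or_gt u₂ n₁ with h₅ | h₅ <;> rcases le_or_gt u₂ n₂ with h₆ | h₆ <;>
            first
            | (exfalso; omega)
            | (simp only [left, right, h, h', h₀, h₁, h₂, h₃, h₄, h₅, h₆]; omega)))

/-- The case `u = (1, 0, -1)` of the trivial module as a tensor factor. -/
theorem signed_sum_eq_ite (a b n₀ n₁ n₂ : ℤ) (ha : 0 ≤ a) (hb : 0 ≤ b)
    (hn₀ : n₁ < n₀) (hn₁ : n₂ < n₁) (h : n₀ + n₁ + n₂ = a - b) :
      max 0 (1 + b - (max 0 (1 - n₀) + max 0 (0 - n₁) + max 0 (-1 - n₂)))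
      - max 0 (1 + b - (max 0 (1 - n₁) + max 0 (0 - n₀) + max 0 (-1 - n₂)))
      - max 0 (1 + b - (max 0 (1 - n₀) + max 0 (0 - n₂) + max 0 (-1 - n₁)))
      - max 0 (1 + b - (max 0 (1 - n₂) + max 0 (0 - n₁) + max 0 (-1 - n₀)))
      + max 0 (1 + b - (max 0 (1 - n₁) + max 0 (0 - n₂) + max 0 (-1 - n₀)))
      + max 0 (1 + b - (max 0 (1 - n₂) + max 0 (0 - n₀) + max 0 (-1 - n₁))) =
      if n₀ = a + 1 ∧ n₁ = 0 ∧ n₂ = -b - 1 then 1 else 0 := by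
  omega

/-! ### Weight multiplicities and tensor product multiplicities -/

theorem mult_eq_zero (y z : ExtWeyl) (h : latticeClass z ≠ latticeClass y) : mult y z = 0 := by
  have : ∀ w, vermaChar (y * fin w) z = 0 := fun w => by
    rw [vermaChar_eq, if_neg]
    rwa [map_mul, latticeClass_fin, mul_one]
  simp only [mult, this, mul_zero, Finset.sum_const_zero]

/-- The closed formula for the multiplicities of a dominant character. -/
theorem mult_eq_max (y z : ExtWeyl) (hy : y ∈ chamber) (hc : latticeClass z = latticeClass y)
    (t₀ t₁ t₂ : ℤ) (h₁ : (iota z).1 = t₀ - t₁) (h₂ : (iota z).2 = t₁ - t₂)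
    (hs : t₀ + t₁ + t₂ = (iota y).1 - (iota y).2) :
    mult y z = max 0 (1 + (iota y).2 - (max 0 (-t₀) + max 0 (-t₁) + max 0 (-t₂))) := by
  obtain ⟨ha, hb⟩ := (mem_chamber y).1 hy
  rw [← kostant_alternating_sum _ _ _ _ _ ha hb hs]
  refine mult_eq y z _ _ ?_ ((mul_inv_mem_affWeyl z y).2 hc) _ _ rfl
  ext
  · simp only [Prod.fst_sub, h₁]
    omega
  · simp only [Prod.snd_sub, h₂]
    omega

/-- The multiplicities of a dominant character are invariant under the finite Weyl group. -/
theorem mult_eq_max_of_act (y z : ExtWeyl) (hy : y ∈ chamber)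
    (hc : latticeClass z = latticeClass y) (v : FinWeyl) (l : Weight) (hz : iota z = act v l)
    (t₀ t₁ t₂ : ℤ) (h₁ : l.1 = t₀ - t₁) (h₂ : l.2 = t₁ - t₂)
    (hs : t₀ + t₁ + t₂ = (iota y).1 - (iota y).2) :
    mult y z = max 0 (1 + (iota y).2 - (max 0 (-t₀) + max 0 (-t₁) + max 0 (-t₂))) := by
  rcases act_cases_weight v l with h | h | h | h | h | h <;> rw [h] at hz <;>
    try rw [h₁, h₂] at hz
  · exact mult_eq_max y z hy hc _ _ _ (by rw [hz, h₁]) (by rw [hz, h₂]) hs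
  · rw [mult_eq_max y z hy hc t₁ t₂ t₀ (by simp [hz]) (by simp [hz]) (by omega)]
    congr 2; ring
  · rw [mult_eq_max y z hy hc t₂ t₀ t₁ (by simp [hz]) (by simp [hz]) (by omega)]
    congr 2; ring
  · rw [mult_eq_max y z hy hc t₁ t₀ t₂ (by simp [hz]) (by simp [hz]) (by omega)]
    congr 2; ring
  · rw [mult_eq_max y z hy hc t₀ t₂ t₁ (by simp [hz]) (by simp [hz]) (by omega)]
    congr 2; ring
  · rw [mult_eq_max y z hy hc t₂ t₁ t₀ (by simp [hz]) (by simp [hz]) (by omega)]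
    congr 2; ring

/-- The structure constant of `χ_z` in `χ_x χ_y` in closed form. Here `n` and `u` are integer
triples representing `iota z + ρ` and `iota y + ρ`. -/
theorem signed_mult_sum (x y z : ExtWeyl) (hx : x ∈ chamber)
    (hc : latticeClass z = latticeClass x * latticeClass y) (u₀ u₁ u₂ n₀ n₁ n₂ : ℤ)
    (hu₁ : (iota y).1 + 1 = u₀ - u₁) (hu₂ : (iota y).2 + 1 = u₁ - u₂)
    (hn₁ : (iota z).1 + 1 = n₀ - n₁) (hn₂ : (iota z).2 + 1 = n₁ - n₂)
    (hs : n₀ + n₁ + n₂ - (u₀ + u₁ + u₂) = (iota x).1 - (iota x).2) :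
    ∑ w : FinWeyl, (Equiv.Perm.sign w : ℤ) * mult x (z * fin w * y⁻¹) =
      max 0 (1 + (iota x).2 - (max 0 (u₀ - n₀) + max 0 (u₁ - n₁) + max 0 (u₂ - n₂)))
      - max 0 (1 + (iota x).2 - (max 0 (u₀ - n₁) + max 0 (u₁ - n₀) + max 0 (u₂ - n₂)))
      - max 0 (1 + (iota x).2 - (max 0 (u₀ - n₀) + max 0 (u₁ - n₂) + max 0 (u₂ - n₁)))
      - max 0 (1 + (iota x).2 - (max 0 (u₀ - n₂) + max 0 (u₁ - n₁) + max 0 (u₂ - n₀)))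
      + max 0 (1 + (iota x).2 - (max 0 (u₀ - n₁) + max 0 (u₁ - n₂) + max 0 (u₂ - n₀)))
      + max 0 (1 + (iota x).2 - (max 0 (u₀ - n₂) + max 0 (u₁ - n₀) + max 0 (u₂ - n₁))) := by
  have key : ∀ (w v : FinWeyl) (m₀ m₁ m₂ : ℤ), w⁻¹ = v →
      act v (iota z + rho) = (m₀ - m₁, m₁ - m₂) → m₀ + m₁ + m₂ = n₀ + n₁ + n₂ →
      mult x (z * fin w * y⁻¹) =
        max 0 (1 + (iota x).2 - (max 0 (u₀ - m₀) + max 0 (u₁ - m₁) + max 0 (u₂ - m₂))) := by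
    rintro w _ m₀ m₁ m₂ rfl hm hsum
    have hi : iota (z * fin w * y⁻¹) =
        act (bar y) (act w⁻¹ (iota z + rho) - rho - iota y) := by
      rw [iota_mul_inv, iota_mul_fin]
    have hcl : latticeClass (z * fin w * y⁻¹) = latticeClass x := by
      rw [map_mul, map_mul, latticeClass_fin, mul_one, map_inv, hc, mul_inv_cancel_right]
    rw [mult_eq_max_of_act x _ hx hcl _ _ hi (m₀ - u₀) (m₁ - u₁) (m₂ - u₂), neg_sub, neg_sub,
      neg_sub]
    · rw [hm]
      simp only [rho, Prod.fst_sub]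
      omega
    · rw [hm]
      simp only [rho, Prod.snd_sub]
      omega
    · omega
  have hz : iota z + rho = (n₀ - n₁, n₁ - n₂) := Prod.ext hn₁ hn₂
  rw [sum_finWeyl, key 1 1 n₀ n₁ n₂ (by decide) _ (by ring),
    key (Equiv.swap 0 1) (Equiv.swap 0 1) n₁ n₀ n₂ (by decide) _ (by ring),
    key (Equiv.swap 1 2) (Equiv.swap 1 2) n₀ n₂ n₁ (by decide) _ (by ring),
    key (Equiv.swap 0 2) (Equiv.swap 0 2) n₂ n₁ n₀ (by decide) _ (by ring),
    key (Equiv.swap 0 1 * Equiv.swap 1 2) (Equiv.swap 1 2 * Equiv.swap 0 1) n₁ n₂ n₀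
      (by decide) _ (by ring),
    key (Equiv.swap 1 2 * Equiv.swap 0 1) (Equiv.swap 0 1 * Equiv.swap 1 2) n₂ n₀ n₁
      (by decide) _ (by ring)]
  · simp
    ring
  all_goals
    simp only [hz, act_one, act_swap_zero_one, act_swap_one_two, act_swap_zero_two,
      act_swap_mul_swap, act_swap_mul_swap']
  all_goals
    ext <;> simp

theorem signed_mult_sum_nonneg (x y z : ExtWeyl) (hx : x ∈ chamber) (hy : y ∈ chamber)
    (hz : z ∈ chamber) :
    0 ≤ ∑ w : FinWeyl, (Equiv.Perm.sign w : ℤ) * mult x (z * fin w * y⁻¹) := by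
  by_cases hc : latticeClass z = latticeClass x * latticeClass y
  · obtain ⟨hy₁, hy₂⟩ := (mem_chamber y).1 hy
    obtain ⟨hz₁, hz₂⟩ := (mem_chamber z).1 hz
    have hdx := iota_dvd x
    have hdy := iota_dvd y
    have hdz := iota_dvd z
    obtain ⟨n, hn⟩ : ∃ n : ℤ, 3 * n = (iota x).1 - (iota x).2 + (iota y).1 + 2 * (iota y).2
        - (iota z).1 - 2 * (iota z).2 := ⟨_, Int.mul_ediv_cancel' (by omega)⟩
    rw [signed_mult_sum x y z hx hc ((iota y).1 + (iota y).2 + 2) ((iota y).2 + 1) 0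
      (n + (iota z).1 + (iota z).2 + 2) (n + (iota z).2 + 1) n (by ring) (by ring) (by ring)
      (by ring) (by linarith)]
    apply signed_sum_nonneg <;> omega
  · refine (Finset.sum_eq_zero fun w _ => ?_).ge
    rw [mult_eq_zero, mul_zero]
    rwa [map_mul, map_mul, latticeClass_fin, mul_one, map_inv, Ne, mul_inv_eq_iff_eq_mul]

theorem signed_mult_sum_one (x z : ExtWeyl) (hx : x ∈ chamber) (hz : z ∈ chamber) :
    ∑ w : FinWeyl, (Equiv.Perm.sign w : ℤ) * mult x (z * fin w) = if x = z then 1 else 0 := by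
  have h1 : ∀ w, mult x (z * fin w) = mult x (z * fin w * 1⁻¹) := by simp
  simp only [h1]
  by_cases hc : latticeClass z = latticeClass x * latticeClass 1
  · obtain ⟨hx₁, hx₂⟩ := (mem_chamber x).1 hx
    obtain ⟨hz₁, hz₂⟩ := (mem_chamber z).1 hz
    have hdx := iota_dvd x
    have hdz := iota_dvd z
    obtain ⟨n, hn⟩ : ∃ n : ℤ, 3 * n = (iota x).1 - (iota x).2
        - (iota z).1 - 2 * (iota z).2 - 3 := ⟨_, Int.mul_ediv_cancel' (by omega)⟩
    rw [signed_mult_sum x 1 z hx hc 1 0 (-1)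
      (n + (iota z).1 + (iota z).2 + 2) (n + (iota z).2 + 1) n (by simp [iota_one])
      (by simp [iota_one]) (by ring) (by ring) (by linarith),
      signed_sum_eq_ite _ _ _ _ _ hx₁ hx₂ (by omega) (by omega) (by linarith)]
    congr 1
    refine propext ⟨fun h => eq_of_iota_eq (Prod.ext (by omega) (by omega)) ?_, ?_⟩
    · simpa using hc.symm
    · rintro rfl
      omega
  · rw [if_neg (by rintro rfl; simp at hc)]
    refine Finset.sum_eq_zero fun w _ => ?_
    rw [mult_eq_zero, mul_zero]
    rwa [map_mul, map_mul, latticeClass_fin, mul_one, map_inv, Ne, mul_inv_eq_iff_eq_mul]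

theorem one_mem_chamber : (1 : ExtWeyl) ∈ chamber := by
  simp [mem_chamber, iota_one]

theorem character_one : character 1 = 1 := by
  ext z
  rw [coeff_character, MonoidAlgebra.one_def, MonoidAlgebra.coeff_single, Finsupp.single_apply]
  by_cases hc : latticeClass z = latticeClass 1
  · obtain ⟨n, hn⟩ := iota_dvd z
    rw [mult_eq_max 1 z one_mem_chamber hc (n + (iota z).2 - (-n)) (-n - n + n) (-n - (iota z).2)
      (by omega) (by omega) (by simp [iota_one])]
    simp only [iota_one, Prod.snd_zero]
    split_ifs with h
    · subst h
      simp [iota_one] at hn ⊢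
      omega
    · have : iota z ≠ 0 := fun h0 => h (eq_of_iota_eq (h0.trans iota_one.symm) hc).symm
      have : ¬ ((iota z).1 = 0 ∧ (iota z).2 = 0) := fun h' => this (Prod.ext h'.1 h'.2)
      omega
  · rw [mult_eq_zero _ _ hc, if_neg]
    rintro rfl
    exact hc rfl

/-! ### The characters lie in the product ring -/

theorem charMap_eq_self {f : MonoidAlgebra ℤ ExtWeyl} (hf : f ∈ productRing) : charMap f = f := by
  have h := mul_charMap hf 1
  rwa [MonoidAlgebra.one_def, charMap_single, character_one, ← MonoidAlgebra.one_def, mul_one,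
    eq_comm] at h

theorem character_mem_of_mul_fin (y : ExtWeyl) (w : FinWeyl)
    (h : character (y * fin w) ∈ productRing) : character y ∈ productRing := by
  have e : y = y * fin w * fin w⁻¹ := by
    rw [mul_assoc, ← fin_mul, mul_inv_cancel, show fin 1 = 1 from rfl, mul_one]
  rw [e, character_mul_fin]
  exact zsmul_mem h _

/-- A character is the product of an orbit sum of translations with a smaller character, minus
two characters. -/
theorem character_mem_of_translates (s : ℤ) (y : ExtWeyl) (i : Fin 3) (n : ℤ)
    (ih : ∀ x, radius (iota x + rho) < n → character x ∈ productRing)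
    (h₀ : radius (iota y + rho - (3 : ℤ) • s • epsWeight i) < n)
    (h : ∀ k ≠ i,
      radius (iota y + rho - (3 : ℤ) • s • epsWeight i + (3 : ℤ) • s • epsWeight k) < n) :
    character y ∈ productRing := by
  set j := bar y i with hj
  have hji : (bar y)⁻¹ j = i := by simp [hj]
  set x := (trans (s • epsWeight j))⁻¹ * y with hx
  have hbx : bar x = bar y := by
    rw [hx, bar_mul, bar_inv]
    simp [bar, trans]
  have hix : iota x = iota y - (3 : ℤ) • s • epsWeight i := by
    have hb : bar (trans (s • epsWeight j)) = 1 := rfl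
    rw [hx, iota_mul, iota_inv, hb, act_one, iota_trans, act_neg, act_zsmul, act_zsmul,
      act_epsWeight, hji, sub_eq_add_neg]
  have hmem : ∑ k, character (trans (s • epsWeight k) * x) ∈ productRing := by
    rw [← sum_trans_mul_character]
    refine mul_mem (sum_trans_mem_productRing s) (ih x ?_)
    rwa [hix, sub_add_eq_add_sub]
  rw [← Finset.add_sum_erase _ _ (Finset.mem_univ j), hx, mul_inv_cancel_left, ← hx] at hmem
  have hrest : ∑ k ∈ Finset.univ.erase j, character (trans (s • epsWeight k) * x) ∈
      productRing := by
    refine sum_mem fun k hk => ih _ ?_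
    have hk' : (bar y)⁻¹ k ≠ i := fun hc => Finset.ne_of_mem_erase hk 
      (Equiv.Perm.inv_eq_iff_eq.1 hc)
    have := h _ hk'
    rwa [iota_mul, hix, iota_trans, hbx, act_zsmul, act_zsmul, act_epsWeight, add_right_comm,
      sub_add_eq_add_sub]
  simpa using sub_mem hmem hrest

theorem character_mem_productRing (y : ExtWeyl) : character y ∈ productRing := by
  induction hn : (radius (iota y + rho)).toNat using Nat.strong_induction_on generalizing y with
  | _ n ih =>
  have hpos : ∀ l, 0 ≤ radius l := fun l => (abs_nonneg _).trans (le_max_left _ _)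
  obtain ⟨w, hw⟩ := exists_mul_fin_mem_chamber y
  apply character_mem_of_mul_fin y w
  replace ih : ∀ x, radius (iota x + rho) < radius (iota (y * fin w) + rho) →
      character x ∈ productRing := fun x hx => by
    rw [radius_iota_mul_fin] at hx
    have := hpos (iota x + rho)
    exact ih _ (by omega) x rfl
  generalize y * fin w = y at hw ih
  obtain ⟨h₁, h₂⟩ := (mem_chamber y).1 hw
  obtain ⟨h₃, h₄, -⟩ := iota_add_rho_ne y
  have h₅ := iota_dvd y
  have hr : radius (iota y + rho) = (iota y).1 + (iota y).2 + 2 := by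
    rw [radius_of_nonneg] <;> simp only [rho, Prod.fst_add, Prod.snd_add] <;> omega
  by_cases ha : 3 ≤ (iota y).1
  · refine character_mem_of_translates 1 y 0 _ ih ?_ fun k hk => ?_ <;> rw [hr, radius_lt]
    · simp [epsWeight, rho]
      omega
    · fin_cases k <;> simp [epsWeight, rho] at hk ⊢ <;> omega
  by_cases hb : 3 ≤ (iota y).2
  · refine character_mem_of_translates (-1) y 2 _ ih ?_ fun k hk => ?_ <;> rw [hr, radius_lt]
    · simp [epsWeight, rho]
      omega
    · fin_cases k <;> simp [epsWeight, rho] at hk ⊢ <;> omega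
  -- The remaining characters are those of the two smallest dominant alcoves.
  have hcases : iota y = 0 ∨ iota y = (1, 1) := by
    simp only [Prod.ext_iff, Prod.fst_zero, Prod.snd_zero]
    omega
  rcases hcases with h | h
  · have := single_mem_productRing y h
    rwa [← charMap_eq_self this, charMap_single] at this
  · set ω := y * (simpleRefl 0)⁻¹ with hω
    have hi : iota ω = 0 := by
      rw [hω, iota_mul_inv, iota_simpleRefl, h, show affRoot 0 = (1, 1) by decide, sub_self]
      simpa using act_sub (bar (simpleRefl 0)) 0 0
    have hmem := mul_mem (single_mem_productRing ω hi) sum_simpleRefl_mem_productRing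
    rw [← charMap_eq_self hmem] at hmem
    simp only [MonoidAlgebra.single_mul_single, mul_one,
      charMap_single, mul_add, map_add, Fin.sum_univ_three] at hmem
    have hi' : ∀ k, iota (ω * simpleRefl k) = affRoot k := fun k => by
      rw [iota_mul, hi, iota_simpleRefl]
      simpa using act_sub (bar (simpleRefl k))⁻¹ 0 0
    have m₁ : character (ω * simpleRefl 1) ∈ productRing := ih _ (by rw [hi', h]; decide)
    have m₂ : character (ω * simpleRefl 2) ∈ productRing := ih _ (by rw [hi', h]; decide)
    -- `ω (s₀ + s₁ + s₂) = χ_y + χ_{ω s₁} + χ_{ω s₂}`.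
    have := sub_mem (sub_mem hmem m₂) m₁
    rw [hω, inv_mul_cancel_right] at this
    simpa using this

/-! ### The basis and its structure constants -/

/-- The linear functional `f ↦ ∑_w det(w) f(z w)`. On the span of the characters it is the
coordinate of `χ_z`. -/
noncomputable def coordinate (z : ExtWeyl) : MonoidAlgebra ℤ ExtWeyl →ₗ[ℤ] ℤ :=
  ∑ w : FinWeyl, (Equiv.Perm.sign w : ℤ) • (Finsupp.lapply (z * fin w)).comp
    (MonoidAlgebra.coeffLinearEquiv ℤ).toLinearMap

theorem coordinate_apply (z : ExtWeyl) (f : MonoidAlgebra ℤ ExtWeyl) :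
    coordinate z f = ∑ w : FinWeyl, (Equiv.Perm.sign w : ℤ) * f.coeff (z * fin w) := by
  simp [coordinate]

theorem coordinate_character (y z : ExtWeyl) (hy : y ∈ chamber) (hz : z ∈ chamber) :
    coordinate z (character y) = if y = z then 1 else 0 := by
  rw [coordinate_apply]
  exact signed_mult_sum_one y z hy hz

theorem coordinate_mul_fin (z : ExtWeyl) (f : MonoidAlgebra ℤ ExtWeyl) (w : FinWeyl) :
    coordinate z (f * MonoidAlgebra.single (fin w) 1) = Equiv.Perm.sign w * coordinate z f := by
  rw [coordinate_apply, coordinate_apply, Finset.mul_sum, ← Equiv.sum_comp (Equiv.mulRight w)]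
  refine Finset.sum_congr rfl fun v _ => ?_
  rw [Equiv.coe_mulRight, MonoidAlgebra.coeff_mul_single_apply, fin_mul, mul_one,
    Equiv.Perm.sign_mul, ← mul_assoc, mul_inv_cancel_right, Units.val_mul]
  ring

/-- The chamber meets every coset `y W̄` in one element. -/
theorem eq_one_of_mem_chamber (y : ExtWeyl) (w : FinWeyl) (hy : y ∈ chamber)
    (hw : y * fin w ∈ chamber) : w = 1 := by
  rw [mem_chamber] at hy hw
  have hi : iota (y * fin w) = iota y := by
    rw [iota_mul_fin] at hw ⊢
    obtain ⟨h₁, h₂⟩ := hy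
    rcases act_cases_weight w⁻¹ (iota y + rho) with h | h | h | h | h | h
    · rw [h, add_sub_cancel_right]
    all_goals
      rw [h] at hw
      simp only [rho, Prod.fst_sub, Prod.snd_sub, Prod.fst_add, Prod.snd_add] at hw
      omega
  have h := eq_of_iota_eq hi (by rw [map_mul, latticeClass_fin, mul_one])
  exact SemidirectProduct.inr_injective (mul_eq_left.1 h)

theorem coordinate_single (y z : ExtWeyl) (hy : y ∈ chamber) (hz : z ∈ chamber) :
    coordinate z (MonoidAlgebra.single y 1) = if y = z then 1 else 0 := by
  rw [coordinate_apply]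
  by_cases h : y = z
  · subst h
    rw [if_pos rfl, Finset.sum_eq_single 1]
    · simp [show fin 1 = 1 from rfl]
    · intro w _ hw
      rw [MonoidAlgebra.coeff_single, Finsupp.single_apply, if_neg, mul_zero]
      intro hc
      exact hw (eq_one_of_mem_chamber y w hy (hc ▸ hy))
    · simp
  · rw [if_neg h]
    refine Finset.sum_eq_zero fun w _ => ?_
    rw [MonoidAlgebra.coeff_single, Finsupp.single_apply, if_neg, mul_zero]
    intro hc
    have hw := eq_one_of_mem_chamber z w hz (hc ▸ hy)
    subst hw
    exact h (hc.trans (mul_one z))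

theorem coordinate_charMap (z : ExtWeyl) (hz : z ∈ chamber) (f : MonoidAlgebra ℤ ExtWeyl) :
    coordinate z (charMap f) = coordinate z f := by
  induction f using MonoidAlgebra.induction_linear with
  | zero => simp
  | add a b ha hb => simp only [map_add, ha, hb]
  | single y n =>
    have e : (MonoidAlgebra.single y n : MonoidAlgebra ℤ ExtWeyl)
        = n • MonoidAlgebra.single y 1 := by simp
    obtain ⟨w, hw⟩ := exists_mul_fin_mem_chamber y
    have h := coordinate_mul_fin z (MonoidAlgebra.single y 1) w
    have h' := coordinate_character (y * fin w) z hw hz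
    rw [MonoidAlgebra.single_mul_single, mul_one, coordinate_single _ z hw hz, ← h',
      character_mul_fin, map_smul, smul_eq_mul] at h
    rw [e, map_smul, map_smul, map_smul, charMap_single]
    congr 1
    exact mul_left_cancel₀ (Units.ne_zero _) h

/-- The coordinates of a product of two characters. -/
theorem coordinate_character_mul (x y z : ExtWeyl) (hz : z ∈ chamber) :
    coordinate z (character x * character y) =
      ∑ w : FinWeyl, (Equiv.Perm.sign w : ℤ) * mult x (z * fin w * y⁻¹) := by
  rw [← charMap_single y, mul_charMap (character_mem_productRing x), coordinate_charMap z hz,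
    coordinate_apply]
  simp only [MonoidAlgebra.coeff_mul_single_apply, mul_one, coeff_character]

theorem characterRing_le : characterRing ≤ productRing :=
  Subring.closure_le.2 (Set.image_subset_iff.2 fun y _ => character_mem_productRing y)

theorem charMap_mem_span (f : MonoidAlgebra ℤ ExtWeyl) :
    charMap f ∈ Submodule.span ℤ (character '' chamber) := by
  induction f using MonoidAlgebra.induction_linear with
  | zero => simp
  | add a b ha hb => simpa only [map_add] using add_mem ha hb
  | single y n =>
    have e : (MonoidAlgebra.single y n : MonoidAlgebra ℤ ExtWeyl)
        = n • MonoidAlgebra.single y 1 := by simp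
    obtain ⟨w, hw⟩ := exists_mul_fin_mem_chamber y
    have h := character_mul_fin (y * fin w) w⁻¹
    rw [mul_assoc, ← fin_mul, mul_inv_cancel, show fin 1 = 1 from rfl, mul_one] at h
    rw [e, map_smul, charMap_single, h]
    exact Submodule.smul_mem _ _ (Submodule.smul_mem _ _
      (Submodule.subset_span (Set.mem_image_of_mem _ hw)))

/-- The characters of the chamber as elements of the character ring. -/
noncomputable def chamberCharacter (y : chamber) : characterRing :=
  ⟨character y, Subring.subset_closure (Set.mem_image_of_mem _ y.2)⟩

/-- The inclusion of the character ring as a linear map. -/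
noncomputable def inclusion : characterRing →ₗ[ℤ] MonoidAlgebra ℤ ExtWeyl :=
  characterRing.subtype.toAddMonoidHom.toIntLinearMap

theorem inclusion_chamberCharacter (y : chamber) :
    inclusion (chamberCharacter y) = character y := rfl

theorem linearIndependent_chamberCharacter : LinearIndependent ℤ chamberCharacter := by
  rw [linearIndependent_iff']
  intro s g hg z hz
  have h := congrArg (fun f => coordinate z (inclusion f)) hg
  simp only [map_sum, map_smul, inclusion_chamberCharacter, map_zero, smul_eq_mul] at h
  rw [Finset.sum_eq_single z] at h
  · simpa [coordinate_character _ _ z.2 z.2] using h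
  · intro y _ hy
    rw [coordinate_character _ _ y.2 z.2, if_neg (fun hc => hy (Subtype.ext hc)), mul_zero]
  · exact fun hn => absurd hz hn

theorem span_chamberCharacter : ⊤ ≤ Submodule.span ℤ (Set.range chamberCharacter) := by
  intro f _
  have hf := charMap_mem_span (f : MonoidAlgebra ℤ ExtWeyl)
  have hr : character '' chamber = inclusion '' Set.range chamberCharacter := by
    rw [← Set.range_comp, Set.image_eq_range]
    rfl
  rw [charMap_eq_self (characterRing_le f.2), hr, ← Submodule.map_span] at hf
  obtain ⟨g, hg, hgf⟩ := hf
  rwa [← Subtype.ext (show (g : MonoidAlgebra ℤ ExtWeyl) = f from hgf)]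


end ExtChar

theorem corollary4p7 :
    ∃ b : Module.Basis ExtChar.chamber ℤ ExtChar.characterRing,
      (∀ y : ExtChar.chamber,
        (b y : MonoidAlgebra ℤ ExtChar.ExtWeyl) = ExtChar.character y) ∧
      ∀ x y z : ExtChar.chamber, 0 ≤ b.repr (b x * b y) z := by
  set b := Module.Basis.mk ExtChar.linearIndependent_chamberCharacter
    ExtChar.span_chamberCharacter with hb
  have hb' : ∀ y, b y = ExtChar.chamberCharacter y := fun y => Module.Basis.mk_apply _ _ y
  refine ⟨b, fun y => by rw [hb']; rfl, fun x y z => ?_⟩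
  have hrepr : (Finsupp.lapply z).comp b.repr.toLinearMap =
      (ExtChar.coordinate z).comp ExtChar.inclusion := by
    refine b.ext fun y => ?_
    rw [LinearMap.comp_apply, LinearMap.comp_apply, hb', ExtChar.inclusion_chamberCharacter,
      ExtChar.coordinate_character _ _ y.2 z.2, ← hb']
    simp [Finsupp.single_apply, Subtype.ext_iff]
  have h := LinearMap.congr_fun hrepr (b x * b y)
  rw [LinearMap.comp_apply, LinearMap.comp_apply] at h
  refine le_of_le_of_eq ?_ h.symm
  rw [hb', hb']
  exact (ExtChar.signed_mult_sum_nonneg x y z x.2 y.2 z.2).trans_eq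
    (ExtChar.coordinate_character_mul x y z z.2).symm
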